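/- Let $(\mathcal D,\mathbb E,\mathfrak s)$ be a small extriangulated category in the sense of Nakaoka–Palu: $\mathcal D$ is an additive category, $\mathbb E:\mathcal D^{op}\times\mathcal D\to\mathrm{Ab}$ is an additive bifunctor, and $\mathfrak s$ is an additive realization satisfying (ET3), (ET3)$^{op}$, (ET4), (ET4)$^{op}$. For $\delta\in\mathbb E(C,A)$, $a:A\to A'$, $c:C'\to C$ write $a\cdot\delta=\mathbb E(C,a)(\delta)$ and $\delta\cdot c=\mathbb E(c,A)(\delta)$; a sequence $A\to B\to C$ realizing some $\delta\in\mathbb E(C,A)$ is called an $\mathfrak s$-conflation. Assume that $\mathcal D$ has a negative first extension: there are given an additive bifunctor $\mathbb E^{-1}:\mathcal D^{op}\times\mathcal D\to\mathrm{Ab}$ and, for each $\delta\in\mathbb E(C,A)$, natural transformations $\delta^{-1}:\mathbb E^{-1}(-,C)\to\mathcal D(-,A)$ and $\delta_{-1}:\mathbb E^{-1}(A,-)\to\mathcal D(C,-)$, such that for every $\mathfrak s$-conflation $A\xrightarrow{u}B\xrightarrow{v}C$ realizing $\delta$ and every $W\in\mathcal D$ the sequences $$\mathbb E^{-1}(W,A)\to\mathbb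 E^{-1}(W,B)\to\mathbb E^{-1}(W,C)\xrightarrow{\delta^{-1}}\mathcal D(W,A)\to\mathcal D(W,B),$$ $$\mathbb E^{-1}(C,W)\to\mathbb E^{-1}(B,W)\to\mathbb E^{-1}(A,W)\xrightarrow{\delta_{-1}}\mathcal D(C,W)\to\mathcal D(B,W)$$ are exact. For $V\in\mathcal D$ put $V^{\perp_0}=\{X:\mathcal D(V,X)=0\}$ and $V^{\perp_1}=\{X:\mathbb E(V,X)=0\}$. Let $\mathrm{Gen}(V)$ be the class of all $X$ such that $X=0$ or there is an $\mathfrak s$-conflation $A\to\coprod_{\alpha}V\xrightarrow{f}X$ with $\alpha$ a set (for which the coproduct exists in $\mathcal D$) and $f\neq0$; let $\mathrm{Pres}(V)$ be defined in the same way with the additional requirement $A\in\mathrm{Gen}(V)$. The object $V$ is called extended tilting if * (T1) $(\mathcal T,\mathcal F):=(\mathrm{Gen}(V),V^{\perp_0})$ is an $s$-torsion pair: both classes are closed under isomorphisms, $\mathcal D(\mathcal T,\mathcal F)=0$, $\mathbb E^{-1}(\mathcal T,\mathcal F)=0$, and every $C\in\mathcal D$ admits an $\mathfrak s$-conflation $T\to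 C\to F$ with $T\in\mathcal T$, $F\in\mathcal F$; * (T2) $\mathrm{Gen}(V)=\mathrm{Pres}(V)$ and $\mathrm{Gen}(V)=V^{\perp_1}$; * (T3) $\mathrm{Gen}(V)$ is cogenerating: every $X\in\mathcal D$ admits an $\mathfrak s$-conflation $X\to S\to D$ with $S\in\mathrm{Gen}(V)$. Define the higher extension groups by $\mathbb E^1:=\mathbb E$ and, for $n\ge1$, $$\mathbb E^{n+1}(A,B):=\Big(\coprod_{C\in\mathcal D}\mathbb E(C,B)\times\mathbb E^n(A,C)\Big)\Big/\approx,$$ where $\approx$ is the equivalence relation generated by $(\delta'\cdot f,\eta)\sim(\delta',f\cdot\eta)$ for $f:X\to Y$, $\delta'\in\mathbb E(Y,B)$, $\eta\in\mathbb E^n(A,X)$; here $\beta\cdot\overline{(\delta,\eta)}:=\overline{(\beta\cdot\delta,\eta)}$ for $\beta:B\to B'$, and the group structure is the Baer sum $$\overline{(\delta,\eta)}+\overline{(\delta',\eta')}:=\overline{(\delta\cdot\pi_1+\delta'\cdot\pi_2,\ \mu_1\cdot\eta+\mu_2\cdot\eta')}$$ over $X\amalg Y$, with $\pi_i$, $\mu_i$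 the canonical projections and inclusions and $X$, $Y$ the middle objects of the two pairs. **Proposition.** If $V\in\mathcal D$ is extended tilting, then $V$ has projective dimension at most one, that is, $$V^{\perp_1}=V^{\perp_{>0}}:=\{X\in\mathcal D:\mathbb E^k(V,X)=0\text{ for all }k>0\}.$$ -/

import Mathlib

open CategoryTheory CategoryTheory.Limits Opposite

universe w v u

namespace Extri

section Bifunctor

variable {D : Type u} [Category.{v} D]

/-- The value `F(C, A)` of a bifunctor `F : Dᵒᵖ × D → Ab`. -/
abbrev Val (F : Dᵒᵖ ⥤ D ⥤ AddCommGrpCat.{w}) (C A : D) : Type w :=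
  (F.obj (op C)).obj A

/-- `a · δ := F(C, a)(δ)`. -/
def push (F : Dᵒᵖ ⥤ D ⥤ AddCommGrpCat.{w}) {C A A' : D} (a : A ⟶ A') :
    Val F C A →+ Val F C A' :=
  ((F.obj (op C)).map a).hom

/-- `δ · c := F(c, A)(δ)`. -/
def pull (F : Dᵒᵖ ⥤ D ⥤ AddCommGrpCat.{w}) {C C' A : D} (c : C' ⟶ C) :
    Val F C A →+ Val F C' A :=
  ((F.map c.op).app A).hom

theorem push_id (F : Dᵒᵖ ⥤ D ⥤ AddCommGrpCat.{w}) {C A : D} (δ : Val F C A) :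
    push F (𝟙 A) δ = δ := by
  simp [push]

theorem push_comp (F : Dᵒᵖ ⥤ D ⥤ AddCommGrpCat.{w}) {C A A' A'' : D} (a : A ⟶ A')
    (a' : A' ⟶ A'') (δ : Val F C A) : push F (a ≫ a') δ = push F a' (push F a δ) := by
  simp [push]

theorem pull_id (F : Dᵒᵖ ⥤ D ⥤ AddCommGrpCat.{w}) {C A : D} (δ : Val F C A) :
    pull F (𝟙 C) δ = δ := by
  simp [pull]

theorem pull_comp (F : Dᵒᵖ ⥤ D ⥤ AddCommGrpCat.{w}) {C C' C'' A : D} (c : C' ⟶ C)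
    (c' : C'' ⟶ C') (δ : Val F C A) : pull F (c' ≫ c) δ = pull F c' (pull F c δ) := by
  simp [pull]

theorem pull_push (F : Dᵒᵖ ⥤ D ⥤ AddCommGrpCat.{w}) {C C' A A' : D} (c : C' ⟶ C)
    (a : A ⟶ A') (δ : Val F C A) : pull F c (push F a δ) = push F a (pull F c δ) :=
  ConcreteCategory.congr_hom ((F.map c.op).naturality a) δ

theorem fmap_comp (F : D ⥤ AddCommGrpCat.{w}) {X Y Z : D} (f : X ⟶ Y) (g : Y ⟶ Z) (η : F.obj X) :
    F.map g (F.map f η) = F.map (f ≫ g) η := by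
  simp

end Bifunctor

variable (D : Type u) [Category.{v} D] [Preadditive D] [HasBinaryBiproducts D]

/-- An extriangulated structure `(𝔼, 𝔰)` on the additive category `D`, in the sense of
Nakaoka and Palu. The realization `𝔰` is given by the relation `Realizes δ x y`, which reads
`𝔰(δ) = [A --x--> B --y--> C]`; the fields `exists_realizes`, `realizes_unique` and
`realizes_of_iso` say that the sequences realizing `δ` are exactly one equivalence class,
two sequences `A ⟶ B ⟶ C` and `A ⟶ B' ⟶ C` being equivalent if there is an isomorphism
`B ≅ B'` compatible with the identities of `A` and `C`. -/
structure Extriangulated where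
  /-- the bifunctor `𝔼` -/
  E : Dᵒᵖ ⥤ D ⥤ AddCommGrpCat.{w}
  additive_left : E.Additive
  additive_right : ∀ X : Dᵒᵖ, (E.obj X).Additive
  /-- the realization `𝔰` -/
  Realizes : ∀ {A B C : D}, Val E C A → (A ⟶ B) → (B ⟶ C) → Prop
  exists_realizes : ∀ {A C : D} (δ : Val E C A),
    ∃ (B : D) (x : A ⟶ B) (y : B ⟶ C), Realizes δ x y
  realizes_unique : ∀ {A B B' C : D} (δ : Val E C A) (x : A ⟶ B) (y : B ⟶ C)
    (x' : A ⟶ B') (y' : B' ⟶ C), Realizes δ x y → Realizes δ x' y' →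
    ∃ b : B ≅ B', x ≫ b.hom = x' ∧ b.hom ≫ y' = y
  realizes_of_iso : ∀ {A B B' C : D} (δ : Val E C A) (x : A ⟶ B) (y : B ⟶ C)
    (x' : A ⟶ B') (y' : B' ⟶ C) (b : B ≅ B'), x ≫ b.hom = x' → b.hom ≫ y' = y →
    Realizes δ x y → Realizes δ x' y'
  /-- every morphism of extensions `(a, c) : δ → δ'` is realized by some `(a, b, c)` -/
  realizes_map : ∀ {A B C A' B' C' : D} (δ : Val E C A) (δ' : Val E C' A')
    (x : A ⟶ B) (y : B ⟶ C) (x' : A' ⟶ B') (y' : B' ⟶ C'),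
    Realizes δ x y → Realizes δ' x' y' →
    ∀ (a : A ⟶ A') (c : C ⟶ C'), push E a δ = pull E c δ' →
    ∃ b : B ⟶ B', x ≫ b = a ≫ x' ∧ b ≫ y' = y ≫ c
  /-- the zero extension is realized by the split sequence -/
  realizes_zero : ∀ A C : D,
    Realizes (0 : Val E C A) (biprod.inl : A ⟶ A ⊞ C) (biprod.snd : A ⊞ C ⟶ C)
  /-- `𝔰(δ ⊕ δ') = 𝔰(δ) ⊕ 𝔰(δ')` -/
  realizes_biprod : ∀ {A B C A' B' C' : D} (δ : Val E C A) (δ' : Val E C' A')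
    (x : A ⟶ B) (y : B ⟶ C) (x' : A' ⟶ B') (y' : B' ⟶ C'),
    Realizes δ x y → Realizes δ' x' y' →
    Realizes
      (push E (biprod.inl : A ⟶ A ⊞ A') (pull E (biprod.fst : C ⊞ C' ⟶ C) δ) +
        push E (biprod.inr : A' ⟶ A ⊞ A') (pull E (biprod.snd : C ⊞ C' ⟶ C') δ'))
      (biprod.map x x') (biprod.map y y')
  et3 : ∀ {A B C A' B' C' : D} (δ : Val E C A) (δ' : Val E C' A')
    (x : A ⟶ B) (y : B ⟶ C) (x' : A' ⟶ B') (y' : B' ⟶ C'),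
    Realizes δ x y → Realizes δ' x' y' →
    ∀ (a : A ⟶ A') (b : B ⟶ B'), x ≫ b = a ≫ x' →
    ∃ c : C ⟶ C', y ≫ c = b ≫ y' ∧ push E a δ = pull E c δ'
  et3_op : ∀ {A B C A' B' C' : D} (δ : Val E C A) (δ' : Val E C' A')
    (x : A ⟶ B) (y : B ⟶ C) (x' : A' ⟶ B') (y' : B' ⟶ C'),
    Realizes δ x y → Realizes δ' x' y' →
    ∀ (b : B ⟶ B') (c : C ⟶ C'), b ≫ y' = y ≫ c →
    ∃ a : A ⟶ A', x ≫ b = a ≫ x' ∧ push E a δ = pull E c δ'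
  et4 : ∀ {A B C X F : D} (δ : Val E X A) (δ' : Val E F B)
    (f : A ⟶ B) (f' : B ⟶ X) (g : B ⟶ C) (g' : C ⟶ F),
    Realizes δ f f' → Realizes δ' g g' →
    ∃ (Y : D) (h' : C ⟶ Y) (d : X ⟶ Y) (e : Y ⟶ F) (δ'' : Val E Y A),
      Realizes δ'' (f ≫ g) h' ∧ f' ≫ d = g ≫ h' ∧ h' ≫ e = g' ∧
      Realizes (push E f' δ') d e ∧ pull E d δ'' = δ ∧ push E f δ'' = pull E e δ'
  et4_op : ∀ {A B C X F : D} (δ : Val E B X) (δ' : Val E C F)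
    (f' : X ⟶ A) (f : A ⟶ B) (g' : F ⟶ B) (g : B ⟶ C),
    Realizes δ f' f → Realizes δ' g' g →
    ∃ (Y : D) (h' : Y ⟶ A) (d : X ⟶ Y) (e : Y ⟶ F) (δ'' : Val E C Y),
      Realizes δ'' h' (f ≫ g) ∧ d ≫ h' = f' ∧ h' ≫ f = e ≫ g' ∧
      Realizes (pull E g' δ) d e ∧ push E e δ'' = δ' ∧ push E d δ = pull E g δ''

/-- An extriangulated category with negative first extension `(𝔼, 𝔰, 𝔼⁻¹)`. For an extension
`δ ∈ 𝔼(C, A)`, the natural transformations `δ⁻¹ : 𝔼⁻¹(-, C) → D(-, A)` and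
`δ₋₁ : 𝔼⁻¹(A, -) → D(C, -)` are `connLeft δ` and `connRight δ`. -/
structure ExtriangulatedNeg extends Extriangulated.{w} D where
  /-- the bifunctor `𝔼⁻¹` -/
  Eneg : Dᵒᵖ ⥤ D ⥤ AddCommGrpCat.{w}
  neg_additive_left : Eneg.Additive
  neg_additive_right : ∀ X : Dᵒᵖ, (Eneg.obj X).Additive
  connLeft : ∀ {A C : D}, Val E C A → ∀ W : D, Val Eneg W C →+ (W ⟶ A)
  connLeft_natural : ∀ {A C : D} (δ : Val E C A) {W W' : D} (f : W' ⟶ W) (t : Val Eneg W C),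
    connLeft δ W' (pull Eneg f t) = f ≫ connLeft δ W t
  connRight : ∀ {A C : D}, Val E C A → ∀ W : D, Val Eneg A W →+ (C ⟶ W)
  connRight_natural : ∀ {A C : D} (δ : Val E C A) {W W' : D} (f : W ⟶ W') (t : Val Eneg A W),
    connRight δ W' (push Eneg f t) = connRight δ W t ≫ f
  exact_left : ∀ {A B C : D} (δ : Val E C A) (x : A ⟶ B) (y : B ⟶ C), Realizes δ x y →
    ∀ W : D,
      Function.Exact (push Eneg x : Val Eneg W A → Val Eneg W B) (push Eneg y) ∧
      Function.Exact (push Eneg y : Val Eneg W B → Val Eneg W C) (connLeft δ W) ∧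
      Function.Exact (connLeft δ W) (fun h : W ⟶ A => h ≫ x)
  exact_right : ∀ {A B C : D} (δ : Val E C A) (x : A ⟶ B) (y : B ⟶ C), Realizes δ x y →
    ∀ W : D,
      Function.Exact (pull Eneg y : Val Eneg C W → Val Eneg B W) (pull Eneg x) ∧
      Function.Exact (pull Eneg x : Val Eneg B W → Val Eneg A W) (connRight δ W) ∧
      Function.Exact (connRight δ W) (fun h : C ⟶ W => y ≫ h)

variable {D}

namespace Extriangulated

variable (S : Extriangulated.{w} D)

/-- `A --x--> B --y--> C` is an `𝔼`-triangle (an `𝔰`-conflation). -/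
def IsConflation {A B C : D} (x : A ⟶ B) (y : B ⟶ C) : Prop :=
  ∃ δ : Val S.E C A, S.Realizes δ x y

/-- The class `𝒳 ⋆ 𝒴` of all `C` with a conflation `X ⟶ C ⟶ Y`, `X ∈ 𝒳`, `Y ∈ 𝒴`. -/
def star (𝒳 𝒴 : ObjectProperty D) : ObjectProperty D := fun C =>
  ∃ (X Y : D) (x : X ⟶ C) (y : C ⟶ Y), 𝒳 X ∧ 𝒴 Y ∧ S.IsConflation x y

/-- `(𝒳, 𝒴)` is a torsion pair. -/
structure IsTorsionPair (𝒳 𝒴 : ObjectProperty D) : Prop where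
  closed_left : 𝒳.IsClosedUnderIsomorphisms
  closed_right : 𝒴.IsClosedUnderIsomorphisms
  hom_zero : ∀ X Y : D, 𝒳 X → 𝒴 Y → ∀ f : X ⟶ Y, f = 0
  star_eq_top : S.star 𝒳 𝒴 = ⊤

/-- `𝒮` is a cogenerating class. -/
def IsCogenerating (𝒮 : ObjectProperty D) : Prop :=
  ∀ X : D, ∃ (T C : D) (x : X ⟶ T) (y : T ⟶ C), 𝒮 T ∧ S.IsConflation x y

/-- `Gen(V)`: the zero objects, and the objects `X` with a conflation `A ⟶ ∐_α V --f--> X`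
in which `f ≠ 0`. (Only the coproduct that is used is required to exist.) -/
def gen (V : D) : ObjectProperty D := fun X =>
  IsZero X ∨
    ∃ (α : Type v) (c : Cofan (fun _ : α => V)) (_ : IsColimit c)
      (A : D) (g : A ⟶ c.pt) (f : c.pt ⟶ X), S.IsConflation g f ∧ f ≠ 0

/-- `Pres(V)`: the zero objects, and the objects `X` with a conflation `A ⟶ ∐_α V --f--> X`
in which `f ≠ 0` and `A ∈ Gen(V)`. -/
def pres (V : D) : ObjectProperty D := fun X =>
  IsZero X ∨
    ∃ (α : Type v) (c : Cofan (fun _ : α => V)) (_ : IsColimit c)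
      (A : D) (g : A ⟶ c.pt) (f : c.pt ⟶ X), S.IsConflation g f ∧ f ≠ 0 ∧ S.gen V A

/-- `V^{⊥₁}`, the objects `X` with `𝔼(V, X) = 0`. -/
def perpOne (V : D) : ObjectProperty D := fun X => ∀ δ : Val S.E V X, δ = 0

end Extriangulated

/-- `V^{⊥₀}`, the objects `X` with `D(V, X) = 0`. -/
def perpZero (V : D) : ObjectProperty D := fun X => ∀ f : V ⟶ X, f = 0

namespace ExtriangulatedNeg

variable (S : ExtriangulatedNeg.{w} D)

/-- `(𝒳, 𝒴)` is an `s`-torsion pair. -/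
structure IsSTorsionPair (𝒳 𝒴 : ObjectProperty D) : Prop extends
    S.toExtriangulated.IsTorsionPair 𝒳 𝒴 where
  neg_zero : ∀ X Y : D, 𝒳 X → 𝒴 Y → ∀ t : Val S.Eneg X Y, t = 0

/-- `V` is an extended tilting object. -/
structure IsExtendedTilting (V : D) : Prop where
  t1 : S.IsSTorsionPair (S.gen V) (perpZero V)
  t2_pres : S.gen V = S.pres V
  t2_perp : S.gen V = S.perpOne V
  t3 : S.IsCogenerating (S.gen V)

end ExtriangulatedNeg

namespace Extriangulated

section Splice

variable (S : Extriangulated.{u} D)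

theorem pull_add {A C C' : D} (f g : C' ⟶ C) (δ : Val S.E C A) :
    pull S.E (f + g) δ = pull S.E f δ + pull S.E g δ := by
  have := S.additive_left
  have h : S.E.map ((f + g).op) = S.E.map f.op + S.E.map g.op := by
    rw [op_add]; exact S.E.map_add
  simp only [pull, h]; rfl

theorem pull_zero {A C C' : D} (δ : Val S.E C A) : pull S.E (0 : C' ⟶ C) δ = 0 := by
  have h := S.pull_add (0 : C' ⟶ C) 0 δ
  rw [add_zero] at h
  simpa using h

theorem push_add {A A' C : D} (f g : A ⟶ A') (δ : Val S.E C A) :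
    push S.E (f + g) δ = push S.E f δ + push S.E g δ := by
  have := S.additive_right (op C)
  simp only [push, Functor.map_add]; rfl

variable (F : D ⥤ AddCommGrpCat.{u})

/-- For a functor `F` (to be thought of as `𝔼ⁿ(A, -)`), the pairs `(δ _C η)` with
`δ ∈ 𝔼(C, B)` and `η ∈ F(C)`, for varying `C`. -/
abbrev SplicePair (B : D) : Type u := Σ C : D, Val S.E C B × F.obj C

/-- `(δ _X η) ∼ (δ' _Y η')` via `f : X ⟶ Y`, i.e. `δ' · f = δ` and `f · η = η'`. -/
def SpliceRel (B : D) (p q : S.SplicePair F B) : Prop :=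
  ∃ f : p.1 ⟶ q.1, pull S.E f q.2.1 = p.2.1 ∧ F.map f p.2.2 = q.2.2

/-- The quotient of the pairs by the equivalence relation generated by `SpliceRel`. -/
def Splice (B : D) : Type u := Quot (S.SpliceRel F B)

namespace Splice

variable {S F}

/-- The class of the pair `(δ _C η)`. -/
def mk {B C : D} (δ : Val S.E C B) (η : F.obj C) : S.Splice F B := Quot.mk _ ⟨C, δ, η⟩

theorem mk_eq {B X Y : D} (f : X ⟶ Y) {δ : Val S.E X B} {η : F.obj X}
    {δ' : Val S.E Y B} {η' : F.obj Y} (h : pull S.E f δ' = δ) (h' : F.map f η = η') :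
    (mk δ η : S.Splice F B) = mk δ' η' :=
  Quot.sound ⟨f, h, h'⟩

theorem ind {B : D} {P : S.Splice F B → Prop}
    (h : ∀ (C : D) (δ : Val S.E C B) (η : F.obj C), P (mk δ η)) (ε : S.Splice F B) : P ε := by
  obtain ⟨C, δ, η⟩ := ε
  exact h C δ η

/-- The Baer sum of pairs,
`(δ _X η) + (δ' _Y η') = ((δ · π₁ + δ' · π₂) _{X ⊞ Y} (μ₁ · η + μ₂ · η'))`. -/
noncomputable def addPair {B : D} (p q : S.SplicePair F B) : S.Splice F B :=
  mk (pull S.E (biprod.fst : p.1 ⊞ q.1 ⟶ p.1) p.2.1 +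
      pull S.E (biprod.snd : p.1 ⊞ q.1 ⟶ q.1) q.2.1)
    (F.map (biprod.inl : p.1 ⟶ p.1 ⊞ q.1) p.2.2 +
      F.map (biprod.inr : q.1 ⟶ p.1 ⊞ q.1) q.2.2)

theorem addPair_congr {B : D} {p p' q q' : S.SplicePair F B} (f : p.1 ⟶ p'.1) (g : q.1 ⟶ q'.1)
    (hf : pull S.E f p'.2.1 = p.2.1) (hf' : F.map f p.2.2 = p'.2.2)
    (hg : pull S.E g q'.2.1 = q.2.1) (hg' : F.map g q.2.2 = q'.2.2) :
    addPair p q = addPair p' q' := by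
  refine mk_eq (biprod.map f g) ?_ ?_
  · rw [← hf, ← hg, map_add, ← pull_comp, ← pull_comp, ← pull_comp, ← pull_comp,
      biprod.map_fst, biprod.map_snd]
  · rw [← hf', ← hg', map_add, fmap_comp, fmap_comp, fmap_comp, fmap_comp,
      biprod.inl_map, biprod.inr_map]

/-- The Baer sum. -/
noncomputable instance {B : D} : Add (S.Splice F B) where
  add := Quot.lift₂ addPair
    (fun p q q' ⟨g, h, h'⟩ => addPair_congr (𝟙 _) g (pull_id _ _) (by simp) h h')
    (fun p p' q ⟨f, h, h'⟩ => addPair_congr f (𝟙 _) h h' (pull_id _ _) (by simp))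

theorem mk_add_mk {B X Y : D} (δ : Val S.E X B) (η : F.obj X) (δ' : Val S.E Y B)
    (η' : F.obj Y) :
    (mk δ η + mk δ' η' : S.Splice F B) =
      mk (pull S.E (biprod.fst : X ⊞ Y ⟶ X) δ + pull S.E (biprod.snd : X ⊞ Y ⟶ Y) δ')
        (F.map (biprod.inl : X ⟶ X ⊞ Y) η + F.map (biprod.inr : Y ⟶ X ⊞ Y) η') := rfl

/-- The class of `(0 _B 0)`. -/
instance {B : D} : Zero (S.Splice F B) := ⟨mk (0 : Val S.E B B) 0⟩

/-- `-[δ _X η] := [(-δ) _X η]`. -/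
instance {B : D} : Neg (S.Splice F B) where
  neg := Quot.map (fun p => ⟨p.1, -p.2.1, p.2.2⟩) (by
    rintro p q ⟨f, h, h'⟩
    exact ⟨f, by rw [map_neg, h], h'⟩)

theorem mk_zero {B X : D} (δ : Val S.E X B) : (mk δ 0 : S.Splice F B) = 0 :=
  (mk_eq (0 : B ⟶ X) (S.pull_zero δ) (map_zero _)).symm

theorem zero_mk [F.Additive] {B X : D} (η : F.obj X) :
    (mk (0 : Val S.E X B) η : S.Splice F B) = 0 :=
  mk_eq (0 : X ⟶ B) (map_zero _) (by rw [F.map_zero]; rfl)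

theorem add_mk [F.Additive] {B X : D} (δ δ' : Val S.E X B) (η : F.obj X) :
    (mk (δ + δ') η : S.Splice F B) = mk δ η + mk δ' η := by
  rw [mk_add_mk]
  refine mk_eq (biprod.inl + biprod.inr) ?_ ?_
  · rw [pull_add, map_add, map_add]
    simp only [← pull_comp, biprod.inl_fst, biprod.inl_snd, biprod.inr_fst, biprod.inr_snd,
      pull_id, pull_zero, add_zero, zero_add]
  · rw [F.map_add]; rfl

noncomputable instance [F.Additive] {B : D} : AddCommGroup (S.Splice F B) where
  add_assoc a b c := by
    induction a using ind with | h X δ η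
    induction b using ind with | h Y δ' η'
    induction c using ind with | h Z δ'' η''
    simp only [mk_add_mk]
    refine mk_eq (biprod.associator X Y Z).hom ?_ ?_
    · simp only [map_add, ← pull_comp, biprod.associator_hom]
      simp [add_assoc]
    · have e₁ : (biprod.inl : X ⟶ X ⊞ Y) ≫ biprod.inl ≫ (biprod.associator X Y Z).hom =
          biprod.inl := by ext <;> simp
      have e₂ : (biprod.inr : Y ⟶ X ⊞ Y) ≫ biprod.inl ≫ (biprod.associator X Y Z).hom =
          biprod.inl ≫ biprod.inr := by ext <;> simp
      have e₃ : biprod.inr ≫ (biprod.associator X Y Z).hom = biprod.inr ≫ biprod.inr := by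
        ext <;> simp
      simp only [map_add, fmap_comp, Category.assoc, add_assoc, e₁, e₂, e₃]
  zero_add a := by
    induction a using ind with | h X δ η
    refine (mk_eq (biprod.inr : X ⟶ B ⊞ X) ?_ ?_).symm
    · simp [← pull_comp, pull_id]
    · simp
  add_zero a := by
    induction a using ind with | h X δ η
    refine (mk_eq (biprod.inl : X ⟶ X ⊞ B) ?_ ?_).symm
    · simp [← pull_comp, pull_id]
    · simp
  add_comm a b := by
    induction a using ind with | h X δ η
    induction b using ind with | h Y δ' η'
    refine mk_eq (biprod.braiding X Y).hom ?_ ?_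
    · simp [← pull_comp, add_comm]
    · simp only [map_add, fmap_comp]
      have e₁ : biprod.inl ≫ (biprod.braiding X Y).hom = biprod.inr := by ext <;> simp
      have e₂ : biprod.inr ≫ (biprod.braiding X Y).hom = biprod.inl := by ext <;> simp
      rw [e₁, e₂, add_comm]
  neg_add_cancel a := by
    induction a using ind with | h X δ η
    change mk (-δ) η + mk δ η = 0
    rw [← add_mk, neg_add_cancel, zero_mk]
  nsmul := nsmulRec
  zsmul := zsmulRec

/-- `β · [δ _C η] := [(β · δ) _C η]`. -/
noncomputable def map [F.Additive] {B B' : D} (β : B ⟶ B') : S.Splice F B →+ S.Splice F B' :=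
  AddMonoidHom.mk' (Quot.map (fun p => ⟨p.1, push S.E β p.2.1, p.2.2⟩) (by
    rintro p q ⟨f, h, h'⟩
    exact ⟨f, by rw [← h, pull_push], h'⟩)) (by
    intro a b
    induction a using ind with | h X δ η
    induction b using ind with | h Y δ' η'
    change mk (push S.E β (_ + _)) _ = mk (_ + _) _
    simp only [map_add, pull_push])

theorem map_mk [F.Additive] {B B' C : D} (β : B ⟶ B') (δ : Val S.E C B) (η : F.obj C) :
    map β (mk δ η : S.Splice F B) = mk (push S.E β δ) η := rfl

end Splice

/-- `B ↦ Splice F B` as a functor to abelian groups. -/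
noncomputable def spliceFunctor [F.Additive] : D ⥤ AddCommGrpCat.{u} where
  obj B := AddCommGrpCat.of (S.Splice F B)
  map β := AddCommGrpCat.ofHom (Splice.map β)
  map_id B := by
    ext ε
    induction ε using Splice.ind with | h X δ η
    exact (Splice.map_mk _ _ _).trans (by rw [push_id]; rfl)
  map_comp β β' := by
    ext ε
    induction ε using Splice.ind with | h X δ η
    exact (Splice.map_mk _ _ _).trans (by rw [push_comp]; rfl)

instance [F.Additive] : (S.spliceFunctor F).Additive where
  map_add := by
    intro B B' β β'
    ext ε
    induction ε using Splice.ind with | h X δ η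
    exact (Splice.map_mk _ _ _).trans (by rw [push_add, Splice.add_mk]; rfl)

/-- `extSucc A n` is the additive functor `𝔼ⁿ⁺¹(A, -)` to abelian groups: `𝔼¹ = 𝔼`, and
`𝔼ⁿ⁺¹(A, B)` consists of the classes of the pairs `(δ _C η)` in `𝔼(C, B) × 𝔼ⁿ(A, C)`. -/
noncomputable def extSucc (A : D) : ℕ → { F : D ⥤ AddCommGrpCat.{u} // F.Additive }
  | 0 => ⟨S.E.obj (op A), S.additive_right (op A)⟩
  | n + 1 =>
    have := (extSucc A n).2
    ⟨S.spliceFunctor (extSucc A n).1, inferInstance⟩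

/-- The higher extension group `𝔼ⁿ⁺¹(A, B)`. -/
abbrev ExtSucc (n : ℕ) (A B : D) : Type u := (S.extSucc A n).1.obj B

/-- `V^{⊥_{>0}}`, the objects `X` with `𝔼ᵏ(V, X) = 0` for all `k > 0`. -/
def perpPos (V : D) : ObjectProperty D := fun X =>
  ∀ (n : ℕ) (ε : S.ExtSucc n V X), ε = 0

/-- The projective dimension of `V` is at most one. -/
def ProjDimLEOne (V : D) : Prop := S.perpOne V = S.perpPos V

end Splice

end Extriangulated

end Extri

namespace Extri

variable {D : Type u} [Category.{v} D] [Preadditive D] [HasBinaryBiproducts D]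

/-! The point is effaceability: every $\delta\in\mathbb E(C,X)$ with $X\in V^{\perp_1}$ is
$\delta'\cdot d$ for some $d:C\to Y$ with $Y\in V^{\perp_1}$ (`exists_pull_eq`). Then
$(\delta,\eta)\approx(\delta',d\cdot\eta)$, and $d\cdot\eta\in\mathbb E^n(V,Y)$ vanishes by
induction on $n$, so $\mathbb E^{n+1}(V,X)=0$.

To find $Y$, realize $\delta$ by $X\to B\to C$, embed $B$ in some $T\in\mathrm{Gen}(V)=V^{\perp_1}$
by (T3), and let (ET4) supply the cone $Y$ of $X\to T$. That $Y\in V^{\perp_1}$ is `perpOne_cone`,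
where the negative extension enters: as $\mathbb E^{-1}$ and $\mathcal D$ vanish from the torsion
class to the torsion-free class, a map from $Y$ to a torsion-free object is zero. So the torsion
part of $Y$ maps onto $Y$ by a split epimorphism, and $V^{\perp_1}$ is closed under retracts. -/

/-- If the deflation of a conflation vanishes, then its inflation is a split epimorphism. -/
theorem Extriangulated.exists_section_of_isConflation_zero (S : Extriangulated.{w} D)
    {T C F : D} (x : T ⟶ C) (h : S.IsConflation x (0 : C ⟶ F)) : ∃ a : C ⟶ T, a ≫ x = 𝟙 C := by
  obtain ⟨δ, hδ⟩ := h
  -- Compare the split conflation $C\to C\oplus C\to C$ with the given one. The right-hand square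
  -- commutes for any middle map, since the deflation is zero; taking the first projection, the
  -- induced map on the left ends is a section of `x`.
  obtain ⟨a, ha, -⟩ := S.et3_op 0 δ biprod.inl biprod.snd x 0 (S.realizes_zero C C) hδ
    biprod.fst 0 (by simp)
  exact ⟨a, by rw [← ha, biprod.inl_fst]⟩

/-- `V^{⊥₁}` is closed under retracts. -/
theorem Extriangulated.perpOne_of_retract (S : Extriangulated.{w} D) {V T C : D}
    (hT : S.perpOne V T) (a : C ⟶ T) (x : T ⟶ C) (h : a ≫ x = 𝟙 C) : S.perpOne V C := by
  intro δ
  rw [← push_id S.E δ, ← h, push_comp, hT (push S.E a δ), map_zero]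

namespace ExtriangulatedNeg

variable {S : ExtriangulatedNeg.{w} D}

/-- The cone of an inflation between objects of the torsion class of an `s`-torsion pair has no
nonzero morphisms to the torsion-free class. -/
theorem IsSTorsionPair.hom_cone_eq_zero {𝒳 𝒴 : ObjectProperty D}
    (h : S.IsSTorsionPair 𝒳 𝒴) {X T C F : D} {x : X ⟶ T} {y : T ⟶ C}
    (hc : S.toExtriangulated.IsConflation x y) (hX : 𝒳 X) (hT : 𝒳 T) (hF : 𝒴 F) (f : C ⟶ F) :
    f = 0 := by
  obtain ⟨δ, hδ⟩ := hc
  -- As $\mathcal D(T,F)=0$, `y ≫ f` vanishes, so exactness at $\mathcal D(C,F)$ lifts `f` to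
  -- $\mathbb E^{-1}(X,F)$, which is zero.
  obtain ⟨t, rfl⟩ := ((S.exact_right δ x y hδ F).2.2 f).1 (h.hom_zero _ _ hT hF _)
  rw [h.neg_zero _ _ hX hF t, map_zero]

/-- For `V` extended tilting, `V^{⊥₁}` is closed under cones of inflations. -/
theorem IsExtendedTilting.perpOne_cone {V : D} (hV : S.IsExtendedTilting V) {X T C : D}
    {x : X ⟶ T} {y : T ⟶ C} (hc : S.toExtriangulated.IsConflation x y)
    (hX : S.toExtriangulated.perpOne V X) (hT : S.toExtriangulated.perpOne V T) :
    S.toExtriangulated.perpOne V C := by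
  have hst : S.toExtriangulated.star (S.gen V) (perpZero V) C := by
    rw [hV.t1.star_eq_top]; trivial
  obtain ⟨T', F, i, p, hT', hF, hip⟩ := hst
  rw [hV.t2_perp] at hT'
  obtain rfl : p = 0 := hV.t1.hom_cone_eq_zero hc (hV.t2_perp ▸ hX) (hV.t2_perp ▸ hT) hF p
  obtain ⟨a, ha⟩ := S.exists_section_of_isConflation_zero i hip
  exact S.perpOne_of_retract hT' a i ha

/-- For `V` extended tilting, every extension of `C` by an object of `V^{⊥₁}` is pulled back from
an extension of some object of `V^{⊥₁}`. -/
theorem IsExtendedTilting.exists_pull_eq {V : D} (hV : S.IsExtendedTilting V) {X C : D}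
    (hX : S.toExtriangulated.perpOne V X) (δ : Val S.E C X) :
    ∃ (Y : D) (d : C ⟶ Y) (δ' : Val S.E Y X),
      S.toExtriangulated.perpOne V Y ∧ pull S.E d δ' = δ := by
  obtain ⟨B, f, f', hf⟩ := S.exists_realizes δ
  obtain ⟨T, Z, g, g', hT, ρ, hg⟩ := hV.t3 B
  -- (ET4) for $X\to B\to T$: `Y` is the cone of the composite inflation, and its extension `δ'`
  -- restricts to `δ` along `d`.
  obtain ⟨Y, h', d, e, δ', hδ', -, -, -, hd, -⟩ := S.et4 δ ρ f f' g g' hf hg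
  exact ⟨Y, d, δ', hV.perpOne_cone ⟨δ', hδ'⟩ hX (hV.t2_perp ▸ hT), hd⟩

/-- Dimension shifting by induction on `n`. The object `X` must stay general, because the inductive
hypothesis is applied to the middle object `Y`. -/
theorem IsExtendedTilting.extSucc_eq_zero {D : Type u} [Category.{u} D] [Preadditive D]
    [HasBinaryBiproducts D] {S : ExtriangulatedNeg.{u} D} {V : D} (hV : S.IsExtendedTilting V)
    (n : ℕ) {X : D} (hX : S.toExtriangulated.perpOne V X)
    (ε : S.toExtriangulated.ExtSucc n V X) : ε = 0 := by
  induction n generalizing X with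
  | zero => exact hX ε
  | succ n ih =>
    induction ε using Extriangulated.Splice.ind with | h C δ η
    obtain ⟨Y, d, δ', hY, hd⟩ := hV.exists_pull_eq hX δ
    -- Sliding `d` across the pair replaces `η` by $d\cdot\eta$, which is zero by induction as $Y\in
    -- V^{\perp_1}$.
    exact (Extriangulated.Splice.mk_eq d hd (ih hY _)).trans (Extriangulated.Splice.mk_zero δ')

end ExtriangulatedNeg

end Extri

theorem proposition5p6 {D : Type u} [SmallCategory D] [Preadditive D] [HasZeroObject D]
    [HasBinaryBiproducts D]
    (S : Extri.ExtriangulatedNeg.{u} D) (V : D) (hV : S.IsExtendedTilting V) :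
    S.toExtriangulated.ProjDimLEOne V := by
  ext X
  -- For the converse, index `0` of `ExtSucc` is $\mathbb E^1=\mathbb E$ itself.
  exact ⟨fun hX n ε => hV.extSucc_eq_zero n hX ε, fun hX => hX 0⟩
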